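/- For $f\in L^2(\mathbb R)$ and the normalized Gaussian window $\phi(x)=2^{1/4}e^{-\pi x^2}$ let $$V_\phi f(\omega,t)=\int_{\mathbb R} f(x)\,\overline{\phi(x-t)}\,e^{-2\pi i\omega x}\,dx$$ be the short-time Fourier transform. For a bounded measurable set $\mathcal E\subseteq\mathbb R^2$ let $P_{\mathcal E}:L^2(\mathbb R)\to L^2(\mathbb R)$ be Daubechies' localization operator, that is, the bounded operator defined weakly by $$\langle P_{\mathcal E}f,g\rangle=\int_{\mathcal E}V_\phi f\,\overline{V_\phi g}\,d\omega\,dt\qquad\text{for all } f,g\in L^2(\mathbb R).$$ Let $M$ be a positive integer, let $\mathcal A$ be a non-empty proper subset of $\{0,1,\dots,M-1\}$ with $|\mathcal A|$ elements, and for $n=0,1,2,\dots$ and $R\ge 0$ put $$C_n^{(d)}(M,\mathcal A)=\Big\{\sum_{j=0}^{n-1}a_jM^j : a_j\in\mathcal A\Big\},\qquad C_n(L,M,\mathcal A)=\bigcup_{m\in C_n^{(d)}(M,\mathcal A)}\big[LM^{-n}m,\;LM^{-n}m+LM^{-n}\big]\quad(L\ge 0),$$ $$\mathcal C_n(R,M,\mathcal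 A)=\{(\omega,t)\in\mathbb R^2:\ \omega^2+t^2\in C_n(R^2,M,\mathcal A)\}.$$ Then there exists a positive, finite constant $B$, depending only on $|\mathcal A|$ and $M$, such that for each $n=0,1,2,\dots$ $$\frac{(\pi R^2+1)^{\frac{\ln|\mathcal A|}{\ln M}}}{|\mathcal A|^n\big(1-e^{-M^{-n}\pi R^2}\big)}\cdot\|P_{\mathcal C_n(R,M,\mathcal A)}\|_{\mathrm{op}}\le B\qquad\text{for all }R\ge 0\text{ with }\pi R^2\in[0,M^n].$$ (At the degenerate endpoint $R=0$ the operator is $0$, and the left-hand side, of the form $0/0$, is read as $0$.) -/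

import Mathlib

open MeasureTheory
open scoped ComplexConjugate

namespace Daubechies

noncomputable section

/-- The Hilbert space `L²(ℝ)` of complex-valued signals. -/
abbrev L2R : Type := Lp ℂ 2 (volume : Measure ℝ)

/-- The short-time Fourier transform of `f` with window `φ`, at frequency `z.1` and time `z.2`:
`V_φ f(ω, t) = ∫ f(x) * conj (φ(x - t)) * exp(-2 π i ω x) dx`. -/
def stft (φ f : ℝ → ℂ) (z : ℝ × ℝ) : ℂ :=
  ∫ x : ℝ, f x * conj (φ (x - z.2)) * Complex.exp (-2 * Real.pi * Complex.I * z.1 * x)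

/-- The time-frequency shift `x ↦ exp(2 π i ω x) * φ(x - t)` of the window. -/
def tfShift (φ : ℝ → ℂ) (z : ℝ × ℝ) (x : ℝ) : ℂ :=
  Complex.exp ((2 * Real.pi * z.1 * x : ℝ) * Complex.I) * φ (x - z.2)

theorem norm_tfShift (φ : ℝ → ℂ) (z : ℝ × ℝ) (x : ℝ) : ‖tfShift φ z x‖ = ‖φ (x - z.2)‖ := by
  rw [tfShift, norm_mul, Complex.norm_exp_ofReal_mul_I, one_mul]

theorem memLp_tfShift {φ : ℝ → ℂ} (hφ : MemLp φ 2 volume) (z : ℝ × ℝ) :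
    MemLp (tfShift φ z) 2 volume := by
  have h : MemLp (fun x => φ (x - z.2)) 2 volume :=
    hφ.comp_measurePreserving (measurePreserving_sub_right volume z.2)
  refine h.congr_norm (AEStronglyMeasurable.mul ?_ h.1) ?_
  · exact Continuous.aestronglyMeasurable (by fun_prop)
  · exact Filter.Eventually.of_forall fun x => (norm_tfShift φ z x).symm

theorem norm_tfShift_toLp {φ : ℝ → ℂ} (hφ : MemLp φ 2 volume) (z : ℝ × ℝ) :
    ‖(memLp_tfShift hφ z).toLp‖ = ‖hφ.toLp‖ := by
  rw [Lp.norm_toLp, Lp.norm_toLp]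
  congr 1
  have h := eLpNorm_comp_measurePreserving (p := 2) hφ.1 (measurePreserving_sub_right volume z.2)
  rw [← h]
  exact eLpNorm_congr_norm_ae (Filter.Eventually.of_forall fun x => norm_tfShift φ z x)

theorem stft_eq_inner {φ : ℝ → ℂ} (hφ : MemLp φ 2 volume) (f : L2R) (z : ℝ × ℝ) :
    stft φ f z = inner ℂ (memLp_tfShift hφ z).toLp f := by
  rw [L2.inner_def, stft]
  refine integral_congr_ae ?_
  filter_upwards [(memLp_tfShift hφ z).coeFn_toLp] with x hx
  rw [hx, RCLike.inner_apply, tfShift, map_mul, ← Complex.exp_conj]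
  simp only [map_mul, Complex.conj_ofReal, Complex.conj_I]
  rw [mul_comm (Complex.exp _) (conj (φ (x - z.2))), ← mul_assoc]
  congr 2
  push_cast
  ring

theorem norm_stft_le {φ : ℝ → ℂ} (hφ : MemLp φ 2 volume) (f : L2R) (z : ℝ × ℝ) :
    ‖stft φ f z‖ ≤ ‖hφ.toLp‖ * ‖f‖ := by
  rw [stft_eq_inner hφ, ← norm_tfShift_toLp hφ z]
  exact norm_inner_le_norm _ _

theorem aestronglyMeasurable_stft {φ : ℝ → ℂ} (hφ : MemLp φ 2 volume) (f : L2R) :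
    AEStronglyMeasurable (stft φ f) volume := by
  have h1 : AEStronglyMeasurable (fun p : (ℝ × ℝ) × ℝ => φ (p.2 - p.1.2))
      ((volume : Measure (ℝ × ℝ)).prod volume) := by
    refine hφ.1.comp_quasiMeasurePreserving ⟨by fun_prop, ?_⟩
    refine Measure.AbsolutelyContinuous.mk fun s hs h0 => ?_
    rw [Measure.map_apply (by fun_prop) hs, Measure.measure_prod_null
      ((by fun_prop : Measurable fun p : (ℝ × ℝ) × ℝ => p.2 - p.1.2) hs)]
    refine Filter.Eventually.of_forall fun z => ?_
    exact ((measurePreserving_sub_right volume z.2).measure_preimage hs.nullMeasurableSet).trans h0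
  have h2 : AEStronglyMeasurable (fun p : (ℝ × ℝ) × ℝ => (f : ℝ → ℂ) p.2)
      ((volume : Measure (ℝ × ℝ)).prod volume) :=
    ((Lp.stronglyMeasurable f).comp_measurable measurable_snd).aestronglyMeasurable
  have h3 : AEStronglyMeasurable (fun p : (ℝ × ℝ) × ℝ =>
      Complex.exp (-2 * Real.pi * Complex.I * p.1.1 * p.2))
      ((volume : Measure (ℝ × ℝ)).prod volume) :=
    Continuous.aestronglyMeasurable (by fun_prop)
  exact ((h2.mul (Complex.continuous_conj.comp_aestronglyMeasurable h1)).mul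
    h3).integral_prod_right'

theorem integrable_weight_mul_stft {φ : ℝ → ℂ} {F : ℝ × ℝ → ℝ} (hφ : MemLp φ 2 volume)
    (hF : Integrable F volume) (f g : L2R) :
    Integrable (fun z => (F z : ℂ) * conj (stft φ f z) * stft φ g z) volume := by
  have h : Integrable (fun z => (F z : ℂ) * conj (stft φ f z)) volume :=
    hF.ofReal.mul_bdd (c := ‖hφ.toLp‖ * ‖f‖)
      (Complex.continuous_conj.comp_aestronglyMeasurable (aestronglyMeasurable_stft hφ f))
      (Filter.Eventually.of_forall fun z => by simpa using norm_stft_le hφ f z)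
  exact h.mul_bdd (c := ‖hφ.toLp‖ * ‖g‖) (aestronglyMeasurable_stft hφ g)
    (Filter.Eventually.of_forall fun z => norm_stft_le hφ g z)

/-- The sesquilinear form `(f, g) ↦ ∫ F * conj (V_φ f) * V_φ g`, linear in `g`. -/
def localizationForm {φ : ℝ → ℂ} {F : ℝ × ℝ → ℝ} (hφ : MemLp φ 2 volume)
    (hF : Integrable F volume) : L2R →L⋆[ℂ] L2R →L[ℂ] ℂ :=
  LinearMap.mkContinuous₂
    (LinearMap.mk₂'ₛₗ (starRingEnd ℂ) (RingHom.id ℂ)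
      (fun f g : L2R => ∫ z, (F z : ℂ) * conj (stft φ f z) * stft φ g z)
      (fun f₁ f₂ g => by
        rw [← integral_add (integrable_weight_mul_stft hφ hF f₁ g)
          (integrable_weight_mul_stft hφ hF f₂ g)]
        refine integral_congr_ae (Filter.Eventually.of_forall fun z => ?_)
        simp only [stft_eq_inner hφ, inner_add_right, map_add]
        ring)
      (fun c f g => by
        rw [smul_eq_mul, ← integral_const_mul]
        refine integral_congr_ae (Filter.Eventually.of_forall fun z => ?_)
        simp only [stft_eq_inner hφ, inner_smul_right, map_mul]
        ring)
      (fun f g₁ g₂ => by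
        rw [← integral_add (integrable_weight_mul_stft hφ hF f g₁)
          (integrable_weight_mul_stft hφ hF f g₂)]
        refine integral_congr_ae (Filter.Eventually.of_forall fun z => ?_)
        simp only [stft_eq_inner hφ, inner_add_right]
        ring)
      (fun c f g => by
        rw [RingHom.id_apply, smul_eq_mul, ← integral_const_mul]
        refine integral_congr_ae (Filter.Eventually.of_forall fun z => ?_)
        simp only [stft_eq_inner hφ, inner_smul_right]
        ring))
    ((∫ z, ‖F z‖) * ‖hφ.toLp‖ ^ 2)
    (fun f g => by
      have hb : Integrable (fun z => ‖F z‖ * (‖hφ.toLp‖ * ‖f‖ * (‖hφ.toLp‖ * ‖g‖))) volume :=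
        hF.norm.mul_const _
      calc _ ≤ ∫ z, ‖F z‖ * (‖hφ.toLp‖ * ‖f‖ * (‖hφ.toLp‖ * ‖g‖)) := by
            refine norm_integral_le_of_norm_le hb (Filter.Eventually.of_forall fun z => ?_)
            rw [norm_mul, norm_mul, RCLike.norm_conj, Complex.norm_real, mul_assoc]
            gcongr
            · exact norm_stft_le hφ f z
            · exact norm_stft_le hφ g z
        _ = _ := by
            rw [integral_mul_const]
            ring)

/-- Daubechies' localization operator `P_{F,φ}` with window `φ ∈ L²(ℝ)` and integrable real
weight `F` on the time-frequency plane: the bounded operator on `L²(ℝ)` given weakly by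
`⟨P f, g⟩ = ⟨F * V_φ f, V_φ g⟩`; see `inner_localizationOperator`. -/
def localizationOperator (φ : ℝ → ℂ) (F : ℝ × ℝ → ℝ) (hφ : MemLp φ 2 volume)
    (hF : Integrable F volume) : L2R →L[ℂ] L2R :=
  InnerProductSpace.continuousLinearMapOfBilin (localizationForm hφ hF)

/-- The weak definition of the localization operator. (Mathlib's `inner` is linear in the
second argument, so the pairing `⟨P f, g⟩`, linear in `f`, is `inner ℂ g (P f)`.) -/
theorem inner_localizationOperator (φ : ℝ → ℂ) (F : ℝ × ℝ → ℝ) (hφ : MemLp φ 2 volume)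
    (hF : Integrable F volume) (f g : L2R) :
    inner ℂ g (localizationOperator φ F hφ hF f) =
      ∫ z, (F z : ℂ) * stft φ f z * conj (stft φ g z) := by
  rw [← inner_conj_symm, localizationOperator,
    InnerProductSpace.continuousLinearMapOfBilin_apply]
  change conj (∫ z, (F z : ℂ) * conj (stft φ f z) * stft φ g z) = _
  rw [← integral_conj]
  simp

/-- The normalized Gaussian window `φ(x) = 2^{1/4} e^{-π x²}`. -/
def gaussianWindow (x : ℝ) : ℂ :=
  (((2 : ℝ) ^ (1 / 4 : ℝ) * Real.exp (-Real.pi * x ^ 2) : ℝ) : ℂ)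

theorem memLp_gaussianWindow : MemLp gaussianWindow 2 volume := by
  have hc : Continuous gaussianWindow := by
    unfold gaussianWindow
    fun_prop
  rw [memLp_two_iff_integrable_sq_norm hc.aestronglyMeasurable]
  have h : Integrable (fun x : ℝ =>
      ((2 : ℝ) ^ (1 / 4 : ℝ)) ^ 2 * Real.exp (-(2 * Real.pi) * x ^ 2)) volume :=
    (integrable_exp_neg_mul_sq (by positivity)).const_mul _
  refine h.congr (Filter.Eventually.of_forall fun x => ?_)
  simp only [gaussianWindow, Complex.norm_real, Real.norm_eq_abs, sq_abs, mul_pow]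
  rw [← Real.exp_nat_mul]
  congr 2
  push_cast
  ring

/-- The `n`-iterate discrete Cantor set with base `M` and alphabet `A`:
all numbers `∑_{j<n} a_j M^j` with digits `a_j ∈ A`. -/
def discreteCantorSet (M : ℕ) (A : Finset ℕ) (n : ℕ) : Set ℕ :=
  {m | ∃ a : Fin n → ℕ, (∀ j, a j ∈ A) ∧ m = ∑ j, a j * M ^ (j : ℕ)}

/-- The `n`-iterate Cantor set based in `[0, L]`: the union of the intervals
`[L M⁻ⁿ m, L M⁻ⁿ m + L M⁻ⁿ]` over the points `m` of the discrete Cantor set. -/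
def cantorSet (L : ℝ) (M : ℕ) (A : Finset ℕ) (n : ℕ) : Set ℝ :=
  ⋃ m ∈ discreteCantorSet M A n,
    Set.Icc (L / (M : ℝ) ^ n * (m : ℝ)) (L / (M : ℝ) ^ n * (m : ℝ) + L / (M : ℝ) ^ n)

/-- The spherically symmetric `n`-iterate Cantor set in the disk of radius `R`. -/
def sphericalCantorSet (R : ℝ) (M : ℕ) (A : Finset ℕ) (n : ℕ) : Set (ℝ × ℝ) :=
  {z | z.1 ^ 2 + z.2 ^ 2 ∈ cantorSet (R ^ 2) M A n}

theorem finite_discreteCantorSet (M : ℕ) (A : Finset ℕ) (n : ℕ) :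
    (discreteCantorSet M A n).Finite := by
  refine (Set.finite_range fun a : Fin n → A => ∑ j, (a j : ℕ) * M ^ (j : ℕ)).subset ?_
  rintro m ⟨a, ha, rfl⟩
  exact ⟨fun j => ⟨a j, ha j⟩, rfl⟩

theorem isCompact_cantorSet (L : ℝ) (M : ℕ) (A : Finset ℕ) (n : ℕ) :
    IsCompact (cantorSet L M A n) :=
  (finite_discreteCantorSet M A n).isCompact_biUnion fun _ _ => isCompact_Icc

theorem isCompact_sphericalCantorSet (R : ℝ) (M : ℕ) (A : Finset ℕ) (n : ℕ) :
    IsCompact (sphericalCantorSet R M A n) := by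
  obtain ⟨C, hC⟩ := (isCompact_cantorSet (R ^ 2) M A n).isBounded.exists_norm_le
  refine Metric.isCompact_of_isClosed_isBounded ?_ ?_
  · exact (isCompact_cantorSet (R ^ 2) M A n).isClosed.preimage
      (by fun_prop : Continuous fun z : ℝ × ℝ => z.1 ^ 2 + z.2 ^ 2)
  · refine isBounded_iff_forall_norm_le.2 ⟨C + 1, fun z hz => ?_⟩
    have h := (le_abs_self _).trans (hC _ hz)
    rw [Prod.norm_def, max_le_iff, Real.norm_eq_abs, Real.norm_eq_abs, abs_le, abs_le]
    refine ⟨⟨?_, ?_⟩, ?_, ?_⟩ <;>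
      nlinarith [sq_nonneg z.1, sq_nonneg z.2, sq_nonneg (z.1 - 1), sq_nonneg (z.1 + 1),
        sq_nonneg (z.2 - 1), sq_nonneg (z.2 + 1)]

theorem integrable_indicator_sphericalCantorSet (R : ℝ) (M : ℕ) (A : Finset ℕ) (n : ℕ) :
    Integrable ((sphericalCantorSet R M A n).indicator (1 : ℝ × ℝ → ℝ)) volume := by
  have h := isCompact_sphericalCantorSet R M A n
  exact (integrable_indicator_iff h.measurableSet).2
    (integrableOn_const (C := (1 : ℝ)) h.measure_lt_top.ne)

/-- The localization operator with Gaussian window whose weight is the characteristic function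
of the spherically symmetric `n`-iterate Cantor set. -/
def cantorLocalizationOperator (R : ℝ) (M : ℕ) (A : Finset ℕ) (n : ℕ) : L2R →L[ℂ] L2R :=
  localizationOperator gaussianWindow ((sphericalCantorSet R M A n).indicator 1)
    memLp_gaussianWindow (integrable_indicator_sphericalCantorSet R M A n)

end

end Daubechies

namespace Daubechies

open FourierTransform ENNReal

/-! The operator norm is at most the largest share of the energy of a spectrogram `|V_φ f|²` that
the Cantor set can carry, so it suffices to bound that share. No eigenvalues are computed; what
matters is that a spectrogram cannot oscillate quickly.

Along a ray through the origin, the derivative of `|V_φ f|²` is at most `2π(|V_φ f|² + |V_ψ f|²)`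
with `ψ(x) = xφ(x)` (`exists_hasDerivAt_spectrogram_ray`). By Moyal's formula, both spectrograms
have total energy at most a constant times `‖f‖²`.

Put `q = R²/Mⁿ`, so that each thin annulus has area `πq`, and group `N` consecutive ones into a
block with `πqN ≥ 1`. On a thin annulus the spectrogram is at most its mean over the block plus the
integral of the derivative bound. Hence a thin annulus carries at most `1/N` of the block's energy
plus an error proportional to `q`. If every block contains at most `K` annuli of the set, summing
over blocks and integrating over angles gives the share `O(Kq)` (`mul_lintegral_annuli_le`,
`exists_lintegral_annuli_spectrogram_le`).

For `M^j ≤ πR² < M^(j+1)` take `N = M^(n-j)`. By self-similarity `K = |A|^(n-j)`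
(`card_filter_div_discreteCantorSet_le`). Since `1 - e^(-πq)` is comparable to `q` and
`(πR²+1)^(ln|A|/ln M) ≤ |A|^(j+2)`, all powers depending on `n` and `j` cancel. -/

/-! ### Plancherel's theorem for integrals -/

theorem fourier_toLp_ae_eq {F : ℝ → ℂ} (h1 : Integrable F) (h2 : MemLp F 2 volume) :
    (𝓕 (h2.toLp F) : Lp ℂ 2 (volume : Measure ℝ)) =ᵐ[volume] 𝓕 F := by
  refine ae_eq_of_integral_contDiff_smul_eq ?_ ?_ ?_
  · exact (Lp.memLp _).locallyIntegrable (by norm_num)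
  · have hc : Continuous (𝓕 F) :=
      VectorFourier.fourierIntegral_continuous Real.continuous_fourierChar
        continuous_inner h1
    exact hc.locallyIntegrable
  · intro g hg hgs
    have hg₁ : HasCompactSupport (Complex.ofRealCLM ∘ g) := hgs.comp_left rfl
    have hg₂ : ContDiff ℝ (⊤ : ℕ∞) (Complex.ofRealCLM ∘ g) := by fun_prop
    set u : SchwartzMap ℝ ℂ := hg₁.toSchwartzMap hg₂ with hu
    have hux : ∀ x, u x = (g x : ℂ) := fun x => rfl
    have e1 := DFunLike.congr_fun (Lp.fourier_toTemperedDistribution_eq (h2.toLp F)) u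
    rw [TemperedDistribution.fourier_apply, Lp.toTemperedDistribution_apply,
      Lp.toTemperedDistribution_apply] at e1
    have e2 : ∫ x, (𝓕 u : SchwartzMap ℝ ℂ) x • (h2.toLp F) x =
        ∫ x, (𝓕 (u : ℝ → ℂ)) x • F x := by
      refine integral_congr_ae ?_
      filter_upwards [h2.coeFn_toLp] with x hx
      rw [hx, SchwartzMap.fourier_coe]
    -- The `L²` transform is defined by duality; the integral transform obeys the same duality, so
    -- both have equal pairings with every test function.
    have e3 := VectorFourier.integral_fourierIntegral_smul_eq_flip (μ := volume) (ν := volume)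
      (L := innerₗ ℝ) Real.continuous_fourierChar continuous_inner (f := (u : ℝ → ℂ)) (g := F)
      (SchwartzMap.integrable u) h1
    rw [flip_innerₗ] at e3
    calc ∫ x, g x • (𝓕 (h2.toLp F) : Lp ℂ 2 (volume : Measure ℝ)) x
        = ∫ x, u x • (𝓕 (h2.toLp F) : Lp ℂ 2 (volume : Measure ℝ)) x := by
          simp [hux]
      _ = ∫ x, u x • (𝓕 F) x := by
          rw [← e1, e2]
          exact e3
      _ = _ := by simp [hux]

theorem lintegral_enorm_sq_eq {α : Type*} [MeasurableSpace α] {μ : Measure α} (f : Lp ℂ 2 μ) :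
    ∫⁻ x, ‖f x‖ₑ ^ 2 ∂μ = ‖f‖ₑ ^ 2 := by
  rw [Lp.enorm_def, eLpNorm_eq_lintegral_rpow_enorm_toReal (by norm_num) (by norm_num)]
  simp only [ENNReal.toReal_ofNat, ENNReal.rpow_ofNat, one_div]
  rw [← ENNReal.rpow_natCast, ← ENNReal.rpow_mul]
  norm_num

/-- Plancherel's theorem for `L¹ ∩ L²`. -/
theorem lintegral_enorm_fourier_sq {F : ℝ → ℂ} (h1 : Integrable F) (h2 : MemLp F 2 volume) :
    ∫⁻ w, ‖𝓕 F w‖ₑ ^ 2 = ∫⁻ x, ‖F x‖ₑ ^ 2 := by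
  have e1 : ∫⁻ w, ‖𝓕 F w‖ₑ ^ 2 = ∫⁻ w, ‖(𝓕 (h2.toLp F) : Lp ℂ 2 (volume : Measure ℝ)) w‖ₑ ^ 2 := by
    refine lintegral_congr_ae ?_
    filter_upwards [fourier_toLp_ae_eq h1 h2] with x hx
    rw [hx]
  have e2 : ∫⁻ x, ‖F x‖ₑ ^ 2 = ∫⁻ x, ‖h2.toLp F x‖ₑ ^ 2 := by
    refine lintegral_congr_ae ?_
    filter_upwards [h2.coeFn_toLp] with x hx
    rw [hx]
  rw [e1, e2, lintegral_enorm_sq_eq, lintegral_enorm_sq_eq, ← ofReal_norm,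
    Lp.norm_fourier_eq, ofReal_norm]

/-! ### Windows dominated by a Gaussian, and Moyal's formula -/

/-- The two exponents differ by `(π/4)(x - 2t)² + (π/2)(T² - t²)`. This gives one integrable
majorant for all shifts `|t| ≤ T`, used for continuity and for differentiation under the integral.
-/
theorem exp_neg_half_sq_sub_le {t T : ℝ} (ht : |t| ≤ T) (x : ℝ) :
    Real.exp (-(Real.pi / 2) * (x - t) ^ 2) ≤
      Real.exp (Real.pi / 2 * T ^ 2) * Real.exp (-(Real.pi / 4) * x ^ 2) := by
  rw [← Real.exp_add, Real.exp_le_exp]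
  have h := sq_le_sq' (abs_le.1 ht).1 (abs_le.1 ht).2
  have := Real.pi_pos
  nlinarith [mul_nonneg this.le (sq_nonneg (x - 2 * t)), mul_nonneg this.le (sub_nonneg.2 h)]

theorem integrable_norm_mul_exp (f : L2R) (c : ℝ) :
    Integrable (fun x => ‖f x‖ * (c * Real.exp (-(Real.pi / 4) * x ^ 2))) volume := by
  have hg : MemLp (fun x : ℝ => c * Real.exp (-(Real.pi / 4) * x ^ 2)) 2 volume := by
    have hc : Continuous (fun x : ℝ => c * Real.exp (-(Real.pi / 4) * x ^ 2)) := by fun_prop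
    rw [memLp_two_iff_integrable_sq_norm hc.aestronglyMeasurable]
    have h : Integrable (fun x : ℝ => c ^ 2 * Real.exp (-(Real.pi / 2) * x ^ 2)) volume :=
      (integrable_exp_neg_mul_sq (by positivity)).const_mul _
    refine h.congr (Filter.Eventually.of_forall fun x => ?_)
    simp only [Real.norm_eq_abs, sq_abs, mul_pow]
    rw [← Real.exp_nat_mul]
    congr 2
    push_cast
    ring
  exact (Lp.memLp f).norm.integrable_mul hg

/-- A continuous window dominated by a Gaussian. -/
structure GaussianDominated (ψ : ℝ → ℂ) (C : ℝ) : Prop where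
  continuous : Continuous ψ
  -- The rate `π/2`, half that of the Gaussian window, leaves room for the factor `x` in `xφ(x)`.
  bound : ∀ y, ‖ψ y‖ ≤ C * Real.exp (-(Real.pi / 2) * y ^ 2)

namespace GaussianDominated

variable {ψ : ℝ → ℂ} {C : ℝ}

theorem nonneg (h : GaussianDominated ψ C) : 0 ≤ C := by
  have := (norm_nonneg _).trans (h.bound 0)
  simpa using this

theorem norm_le (h : GaussianDominated ψ C) (y : ℝ) : ‖ψ y‖ ≤ C := by
  refine (h.bound y).trans (mul_le_of_le_one_right h.nonneg ?_)
  rw [Real.exp_le_one_iff]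
  have := Real.pi_pos
  nlinarith [sq_nonneg y]

theorem norm_sub_le (h : GaussianDominated ψ C) {t T : ℝ} (ht : |t| ≤ T) (x : ℝ) :
    ‖ψ (x - t)‖ ≤ C * Real.exp (Real.pi / 2 * T ^ 2) * Real.exp (-(Real.pi / 4) * x ^ 2) := by
  refine (h.bound _).trans ?_
  rw [mul_assoc]
  exact mul_le_mul_of_nonneg_left (exp_neg_half_sq_sub_le ht x) h.nonneg

theorem memLp (h : GaussianDominated ψ C) : MemLp ψ 2 volume := by
  rw [memLp_two_iff_integrable_sq_norm h.continuous.aestronglyMeasurable]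
  have hi : Integrable (fun x : ℝ => C ^ 2 * Real.exp (-Real.pi * x ^ 2)) volume :=
    (integrable_exp_neg_mul_sq Real.pi_pos).const_mul _
  refine hi.mono' (h.continuous.norm.pow 2).aestronglyMeasurable
    (Filter.Eventually.of_forall fun x => ?_)
  rw [norm_pow, norm_norm]
  refine (pow_le_pow_left₀ (norm_nonneg _) (h.bound x) 2).trans_eq ?_
  rw [mul_pow, ← Real.exp_nat_mul]
  congr 2
  push_cast
  ring

theorem norm_exp_stft (w x : ℝ) :
    ‖Complex.exp (-2 * Real.pi * Complex.I * w * x)‖ = 1 := by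
  rw [show (-2 * Real.pi * Complex.I * w * x : ℂ) = ((-2 * Real.pi * w * x : ℝ) : ℂ) * Complex.I by
    push_cast; ring, Complex.norm_exp_ofReal_mul_I]

theorem norm_integrand_le (h : GaussianDominated ψ C) (f : L2R) {t T : ℝ} (ht : |t| ≤ T)
    (w x : ℝ) :
    ‖f x * conj (ψ (x - t)) * Complex.exp (-2 * Real.pi * Complex.I * w * x)‖ ≤
      ‖f x‖ * (C * Real.exp (Real.pi / 2 * T ^ 2) * Real.exp (-(Real.pi / 4) * x ^ 2)) := by
  rw [norm_mul, norm_exp_stft, mul_one, norm_mul, RCLike.norm_conj]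
  exact mul_le_mul_of_nonneg_left (h.norm_sub_le ht x) (norm_nonneg _)

theorem aestronglyMeasurable_integrand (h : GaussianDominated ψ C) (f : L2R) (t w : ℝ) :
    AEStronglyMeasurable
      (fun x : ℝ => f x * conj (ψ (x - t)) * Complex.exp (-2 * Real.pi * Complex.I * w * x))
      volume := by
  have := h.continuous
  exact ((Lp.stronglyMeasurable f).aestronglyMeasurable.mul
    (Continuous.aestronglyMeasurable (by fun_prop))).mul
    (Continuous.aestronglyMeasurable (by fun_prop))

theorem integrable_integrand (h : GaussianDominated ψ C) (f : L2R) (t w : ℝ) :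
    Integrable
      (fun x : ℝ => f x * conj (ψ (x - t)) * Complex.exp (-2 * Real.pi * Complex.I * w * x))
      volume :=
  (integrable_norm_mul_exp f _).mono' (h.aestronglyMeasurable_integrand f t w)
    (Filter.Eventually.of_forall fun x => h.norm_integrand_le f le_rfl w x)

theorem continuous_stft (h : GaussianDominated ψ C) (f : L2R) : Continuous (stft ψ f) := by
  refine continuous_iff_continuousAt.2 fun z₀ => ?_
  refine continuousAt_of_dominated (bound := fun x => ‖f x‖ *
    (C * Real.exp (Real.pi / 2 * (|z₀.2| + 1) ^ 2) * Real.exp (-(Real.pi / 4) * x ^ 2))) ?_ ?_ ?_ ?_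
  · exact Filter.Eventually.of_forall fun z => h.aestronglyMeasurable_integrand f z.2 z.1
  · have ho : ∀ᶠ z : ℝ × ℝ in nhds z₀, |z.2| < |z₀.2| + 1 :=
      (by fun_prop : Continuous fun z : ℝ × ℝ => |z.2|).continuousAt.eventually_lt
        continuousAt_const (by simp)
    filter_upwards [ho] with z hz
    exact Filter.Eventually.of_forall fun x => h.norm_integrand_le f hz.le z.1 x
  · exact integrable_norm_mul_exp f _
  · refine Filter.Eventually.of_forall fun x => Continuous.continuousAt ?_
    have := h.continuous
    fun_prop

/-- Moyal's formula: the short-time Fourier transform preserves energy. -/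
theorem lintegral_enorm_stft_sq (h : GaussianDominated ψ C) (f : L2R) :
    ∫⁻ z, ‖stft ψ f z‖ₑ ^ 2 = ‖f‖ₑ ^ 2 * ∫⁻ y, ‖ψ y‖ₑ ^ 2 := by
  have hψ := h.continuous
  have hfm : Measurable fun x => ‖f x‖ₑ ^ 2 := (Lp.stronglyMeasurable f).measurable.enorm.pow_const 2
  -- For fixed `t`, the function `w ↦ V_ψ f(w, t)` is the Fourier transform of `f · conj ψ(· - t)`;
  -- Plancherel applies to each slice, and Tonelli then separates `f` from `ψ`.
  have hslice (t : ℝ) : ∫⁻ w, ‖stft ψ f (w, t)‖ₑ ^ 2 = ∫⁻ x, ‖f x‖ₑ ^ 2 * ‖ψ (x - t)‖ₑ ^ 2 := by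
    have h1 : Integrable (fun x : ℝ => f x * conj (ψ (x - t))) volume := by
      simpa using h.integrable_integrand f t 0
    have h2 : MemLp (fun x : ℝ => f x * conj (ψ (x - t))) 2 volume := by
      refine ((Lp.memLp f).const_mul (C : ℂ)).mono h1.1 (Filter.Eventually.of_forall fun x => ?_)
      rw [norm_mul, norm_mul, RCLike.norm_conj, Complex.norm_real, Real.norm_of_nonneg h.nonneg,
        mul_comm]
      exact mul_le_mul_of_nonneg_right (h.norm_le _) (norm_nonneg _)
    have e : ∀ w, stft ψ f (w, t) = 𝓕 (fun x : ℝ => f x * conj (ψ (x - t))) w := by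
      intro w
      rw [Real.fourier_real_eq_integral_exp_smul, stft]
      refine integral_congr_ae (Filter.Eventually.of_forall fun x => ?_)
      simp only [smul_eq_mul]
      rw [mul_comm]
      congr 2
      push_cast
      ring
    simp_rw [e]
    rw [lintegral_enorm_fourier_sq h1 h2]
    refine lintegral_congr fun x => ?_
    rw [enorm_mul, mul_pow, RCLike.enorm_conj]
  rw [Measure.volume_eq_prod, lintegral_prod_symm _
    ((h.continuous_stft f).enorm.measurable.pow_const 2).aemeasurable]
  simp_rw [hslice]
  rw [lintegral_lintegral_swap]
  · have (x : ℝ) : ∫⁻ t, ‖f x‖ₑ ^ 2 * ‖ψ (x - t)‖ₑ ^ 2 = ‖f x‖ₑ ^ 2 * ∫⁻ y, ‖ψ y‖ₑ ^ 2 := by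
      have hm : Measurable fun t => ‖ψ (x - t)‖ₑ ^ 2 :=
        Measurable.pow_const (Continuous.measurable (by fun_prop)) 2
      rw [lintegral_const_mul _ hm, lintegral_sub_left_eq_self (fun y => ‖ψ y‖ₑ ^ 2) x]
    simp_rw [this]
    rw [lintegral_mul_const _ hfm, lintegral_enorm_sq_eq]
  · refine Measurable.aemeasurable ?_
    refine (hfm.comp measurable_snd).mul (Measurable.pow_const (Continuous.measurable ?_) 2)
    fun_prop

end GaussianDominated

/-! ### Mass on thin annuli along one ray -/

theorem lintegral_Ioc_ofReal_id {a b : ℝ} (ha : 0 ≤ a) (hab : a ≤ b) :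
    ∫⁻ r in Set.Ioc a b, ENNReal.ofReal r = ENNReal.ofReal ((b ^ 2 - a ^ 2) / 2) := by
  have hi : IntegrableOn (fun r : ℝ => r) (Set.Ioc a b) :=
    (continuous_id.integrableOn_Icc (a := a) (b := b)).mono_set Set.Ioc_subset_Icc_self
  rw [← ofReal_integral_eq_lintegral_ofReal hi, ← intervalIntegral.integral_of_le hab, integral_id]
  filter_upwards [ae_restrict_mem measurableSet_Ioc] with r hr
  exact ha.trans hr.1.le

/-- A bound for the mass of a function `G`, whose oscillation is controlled by `D`, on thin annuli:
if at most `K` of the annuli `q m ≤ r² ≤ q m + q`, `m ∈ S`, lie in each annulus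
`q N p ≤ r² ≤ q N (p + 1)`, then the mass of `G` on their union is controlled by the total mass and
the integral of `D`. -/
theorem mul_lintegral_annuli_le {G D : ℝ → ℝ≥0∞} (hG : Measurable G)
    (hGD : ∀ a b r s : ℝ, 0 ≤ a → r ∈ Set.Icc a b → s ∈ Set.Icc a b →
      G r ≤ G s + ∫⁻ u in Set.Ioc a b, D u)
    {q : ℝ} (hq : 0 ≤ q) (S : Finset ℕ) {N : ℕ} (hN : 0 < N) {K : ℕ}
    (hK : ∀ p, (S.filter (fun m => m / N = p)).card ≤ K) :
    (N : ℝ≥0∞) * ∫⁻ r in Set.Ioi 0, ENNReal.ofReal r *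
        ({r : ℝ | ∃ m ∈ S, r ^ 2 ∈ Set.Icc (q * m) (q * m + q)}.indicator G r) ≤
      K * ((∫⁻ r in Set.Ioi 0, ENNReal.ofReal r * G r) +
        ENNReal.ofReal (q * N / 2) * ∫⁻ r in Set.Ioi 0, D r) := by
  have hrG : Measurable fun r => ENNReal.ofReal r * G r := ENNReal.measurable_ofReal.mul hG
  have hN' : (0 : ℝ) < N := by exact_mod_cast hN
  -- Block radii: equal increments of `r²`, so every block has the same mass `qN/2` for `r dr`.
  set A : ℕ → ℝ := fun p => √(q * N * p) with hA
  have hA0 (p : ℕ) : 0 ≤ A p := Real.sqrt_nonneg _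
  have hAsq (p : ℕ) : A p ^ 2 = q * N * p := Real.sq_sqrt (by positivity)
  have hAmono : Monotone A := fun p p' h => Real.sqrt_le_sqrt (by gcongr)
  have hdiff (p : ℕ) : (A (p + 1) ^ 2 - A p ^ 2) / 2 = q * N / 2 := by
    rw [hAsq, hAsq]; push_cast; ring
  set Y : ℕ → ℝ≥0∞ := fun p => (∫⁻ r in Set.Ioc (A p) (A (p + 1)), ENNReal.ofReal r * G r) +
    ENNReal.ofReal (q * N / 2) * ∫⁻ r in Set.Ioc (A p) (A (p + 1)), D r with hY
  -- Averaging the oscillation bound over `s` in the block bounds `G r` by the block's mean plus the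
  -- integral of `D`.
  have hsup (p : ℕ) (r : ℝ) (hr : r ∈ Set.Icc (A p) (A (p + 1))) :
      ENNReal.ofReal (q * N / 2) * G r ≤ Y p := by
    rw [← hdiff p, ← lintegral_Ioc_ofReal_id (hA0 p) (hAmono p.le_succ),
      ← lintegral_mul_const _ ENNReal.measurable_ofReal]
    calc ∫⁻ s in Set.Ioc (A p) (A (p + 1)), ENNReal.ofReal s * G r
        ≤ ∫⁻ s in Set.Ioc (A p) (A (p + 1)), (ENNReal.ofReal s * G s +
            ENNReal.ofReal s * ∫⁻ u in Set.Ioc (A p) (A (p + 1)), D u) := by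
          refine setLIntegral_mono' measurableSet_Ioc fun s hs => ?_
          rw [← mul_add]
          gcongr
          exact hGD _ _ _ _ (hA0 p) hr (Set.Ioc_subset_Icc_self hs)
      _ = Y p := by
          rw [lintegral_add_left hrG,
            lintegral_mul_const _ ENNReal.measurable_ofReal,
            lintegral_Ioc_ofReal_id (hA0 p) (hAmono p.le_succ), hdiff p]
  -- A thin annulus has mass `q/2` for `r dr`, which is `1/N` of that of the block containing it.
  have hone (m : ℕ) : (N : ℝ≥0∞) * ∫⁻ r in Set.Icc (√(q * m)) (√(q * m + q)),
      ENNReal.ofReal r * G r ≤ Y (m / N) := by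
    have hsub : √(q * m) ≤ √(q * m + q) := Real.sqrt_le_sqrt (by linarith)
    have hm1 : (m / N : ℕ) * N ≤ m := Nat.div_mul_le_self m N
    -- The `+ 1` keeps the outer radius of annulus `m` inside block `m / N` as well.
    have hm2 : m + 1 ≤ (m / N + 1) * N := by
      have := Nat.lt_div_mul_add (a := m) hN
      rw [add_mul, one_mul]; omega
    have hm1' : ((m / N : ℕ) : ℝ) * N ≤ m := by exact_mod_cast hm1
    have hm2' : (m : ℝ) + 1 ≤ (((m / N + 1 : ℕ) : ℝ)) * N := by exact_mod_cast hm2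
    have hin : ∀ r ∈ Set.Icc (√(q * m)) (√(q * m + q)),
        r ∈ Set.Icc (A (m / N)) (A (m / N + 1)) := by
      intro r hr
      refine ⟨le_trans (Real.sqrt_le_sqrt ?_) hr.1, hr.2.trans (Real.sqrt_le_sqrt ?_)⟩
      · nlinarith
      · nlinarith
    rw [setLIntegral_congr Ioc_ae_eq_Icc.symm, ← lintegral_const_mul _ hrG]
    rcases hq.eq_or_lt with rfl | hq
    · simp
    set c : ℝ := q / 2
    have hc : 0 < c := by positivity
    have hcN : ENNReal.ofReal (q * N / 2) = ENNReal.ofReal c * N := by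
      rw [← ENNReal.ofReal_natCast, ← ENNReal.ofReal_mul hc.le]
      congr 1; ring
    have hc0 : ENNReal.ofReal c ≠ 0 := by simpa using hc
    calc ∫⁻ r in Set.Ioc (√(q * m)) (√(q * m + q)), (N : ℝ≥0∞) * (ENNReal.ofReal r * G r)
        ≤ ∫⁻ r in Set.Ioc (√(q * m)) (√(q * m + q)),
            ENNReal.ofReal r * ((ENNReal.ofReal c)⁻¹ * Y (m / N)) := by
          refine setLIntegral_mono' measurableSet_Ioc fun r hr => ?_
          rw [mul_left_comm]
          refine mul_le_mul' le_rfl ?_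
          rw [mul_comm _ (Y _), ← div_eq_mul_inv, ENNReal.le_div_iff_mul_le (Or.inl hc0)
            (Or.inl ENNReal.ofReal_ne_top), mul_comm, ← mul_assoc, ← hcN]
          exact hsup _ _ (hin r (Set.Ioc_subset_Icc_self hr))
      _ = Y (m / N) := by
          rw [lintegral_mul_const _ ENNReal.measurable_ofReal,
            lintegral_Ioc_ofReal_id (Real.sqrt_nonneg _) hsub, Real.sq_sqrt (by positivity),
            Real.sq_sqrt (by positivity), show (q * m + q - q * m) / 2 = c by ring, ← mul_assoc,
            ENNReal.mul_inv_cancel hc0 ENNReal.ofReal_ne_top, one_mul]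
  -- Half-open blocks are disjoint, so no energy is counted twice.
  have hblocks (H : ℝ → ℝ≥0∞) (T : Finset ℕ) :
      ∑ p ∈ T, ∫⁻ r in Set.Ioc (A p) (A (p + 1)), H r ≤ ∫⁻ r in Set.Ioi 0, H r := by
    have hd : (T : Set ℕ).PairwiseDisjoint fun p => Set.Ioc (A p) (A (p + 1)) :=
      fun i _ j _ hij => hAmono.pairwise_disjoint_on_Ioc_succ hij
    rw [← lintegral_biUnion_finset hd (fun _ _ => measurableSet_Ioc)]
    refine lintegral_mono_set (Set.iUnion₂_subset fun p _ r hr => ?_)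
    exact (hA0 p).trans_lt hr.1
  -- Only an upper bound holds in general: neighbouring closed annuli may share a boundary circle.
  have hcover : ∫⁻ r in Set.Ioi 0, ENNReal.ofReal r *
      ({r : ℝ | ∃ m ∈ S, r ^ 2 ∈ Set.Icc (q * m) (q * m + q)}.indicator G r) ≤
      ∑ m ∈ S, ∫⁻ r in Set.Icc (√(q * m)) (√(q * m + q)), ENNReal.ofReal r * G r := by
    simp_rw [← lintegral_indicator measurableSet_Icc]
    rw [← lintegral_finsetSum _ (fun m _ => hrG.indicator measurableSet_Icc)]
    refine (setLIntegral_mono' measurableSet_Ioi fun r hr => ?_).trans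
      (setLIntegral_le_lintegral _ _)
    by_cases h : r ∈ {r : ℝ | ∃ m ∈ S, r ^ 2 ∈ Set.Icc (q * m) (q * m + q)}
    · obtain ⟨m, hm, h1, h2⟩ := id h
      rw [Set.indicator_of_mem h]
      refine le_trans ?_ (Finset.single_le_sum (f := fun m : ℕ =>
        (Set.Icc (√(q * m)) (√(q * m + q))).indicator (fun r => ENNReal.ofReal r * G r) r)
        (fun _ _ => zero_le) hm)
      have hr0 : (0 : ℝ) ≤ r := le_of_lt hr
      rw [Set.indicator_of_mem]
      exact ⟨Real.sqrt_le_iff.2 ⟨hr0, h1⟩, Real.le_sqrt_of_sq_le h2⟩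
    · rw [Set.indicator_of_notMem h]
      simp
  calc _ ≤ (N : ℝ≥0∞) * ∑ m ∈ S, ∫⁻ r in Set.Icc (√(q * m)) (√(q * m + q)),
          ENNReal.ofReal r * G r := by gcongr
    _ ≤ ∑ m ∈ S, Y (m / N) := by
        rw [Finset.mul_sum]
        exact Finset.sum_le_sum fun m _ => hone m
    _ = ∑ p ∈ S.image (· / N), (S.filter (fun m => m / N = p)).card • Y p :=
        Finset.sum_comp Y (· / N)
    _ ≤ ∑ p ∈ S.image (· / N), K * Y p := by
        refine Finset.sum_le_sum fun p _ => ?_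
        rw [nsmul_eq_mul]
        gcongr
        exact hK p
    _ ≤ _ := by
        rw [← Finset.mul_sum]
        gcongr
        rw [hY, Finset.sum_add_distrib, ← Finset.mul_sum]
        gcongr
        · exact hblocks _ _
        · exact hblocks _ _

/-! ### Spectrograms along rays -/

/-- The window `x ↦ x φ(x)`, with `φ` the normalized Gaussian. -/
noncomputable def mulGaussianWindow (x : ℝ) : ℂ := x * gaussianWindow x

theorem norm_gaussianWindow (y : ℝ) :
    ‖gaussianWindow y‖ = (2 : ℝ) ^ (1 / 4 : ℝ) * Real.exp (-Real.pi * y ^ 2) := by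
  rw [gaussianWindow, Complex.norm_real, Real.norm_of_nonneg (by positivity)]

theorem conj_gaussianWindow (y : ℝ) : conj (gaussianWindow y) = gaussianWindow y := by
  rw [gaussianWindow, Complex.conj_ofReal]

theorem gaussianDominated_gaussianWindow :
    GaussianDominated gaussianWindow ((2 : ℝ) ^ (1 / 4 : ℝ)) where
  continuous := by
    unfold gaussianWindow
    fun_prop
  bound y := by
    rw [norm_gaussianWindow]
    gcongr ?_ * ?_
    rw [Real.exp_le_exp]
    nlinarith [Real.pi_pos, mul_nonneg Real.pi_pos.le (sq_nonneg y)]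

theorem abs_mul_exp_le (y : ℝ) :
    |y| * Real.exp (-Real.pi * y ^ 2) ≤ Real.exp (-(Real.pi / 2) * y ^ 2) := by
  have h1 : |y| ≤ Real.exp (Real.pi / 2 * y ^ 2) := by
    have := Real.add_one_le_exp (Real.pi / 2 * y ^ 2)
    have := Real.pi_gt_three
    nlinarith [sq_nonneg (|y| - 1), sq_abs y, sq_nonneg y, mul_nonneg (sub_nonneg.2 this.le)
      (sq_nonneg y)]
  calc |y| * Real.exp (-Real.pi * y ^ 2)
      ≤ Real.exp (Real.pi / 2 * y ^ 2) * Real.exp (-Real.pi * y ^ 2) := by gcongr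
    _ = _ := by rw [← Real.exp_add]; congr 1; ring

theorem gaussianDominated_mulGaussianWindow :
    GaussianDominated mulGaussianWindow ((2 : ℝ) ^ (1 / 4 : ℝ)) where
  continuous := by
    have := gaussianDominated_gaussianWindow.continuous
    unfold mulGaussianWindow
    fun_prop
  bound y := by
    rw [mulGaussianWindow, norm_mul, norm_gaussianWindow, Complex.norm_real, Real.norm_eq_abs,
      mul_left_comm]
    gcongr
    exact abs_mul_exp_le y

theorem hasDerivAt_gaussianWindow_ray (x s r : ℝ) :
    HasDerivAt (fun r : ℝ => gaussianWindow (x - r * s))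
      ((2 * Real.pi * s * (x - r * s) : ℝ) * gaussianWindow (x - r * s)) r := by
  have h1 : HasDerivAt (fun r : ℝ => -Real.pi * (x - r * s) ^ 2)
      (2 * Real.pi * s * (x - r * s)) r := by
    have := ((((hasDerivAt_id r).mul_const s).const_sub x).pow 2).const_mul (-Real.pi)
    refine this.congr_deriv ?_
    simp
    ring
  have h2 := (h1.exp.const_mul ((2 : ℝ) ^ (1 / 4 : ℝ))).ofReal_comp
  refine h2.congr_deriv ?_
  simp only [gaussianWindow]
  push_cast
  ring

/-- Differentiating the Gaussian produces `x - rs`, differentiating the exponential produces `x`.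
Writing `x = (x - rs) + rs` leaves the window `xφ(x)` and a multiple of the original integrand. -/
theorem hasDerivAt_stft_integrand_ray (v : ℂ) (x c s r : ℝ) :
    HasDerivAt (fun r : ℝ => v * conj (gaussianWindow (x - r * s)) *
        Complex.exp (-2 * Real.pi * Complex.I * (r * c : ℝ) * x))
      (2 * Real.pi * (s - Complex.I * c) * (v * conj (mulGaussianWindow (x - r * s)) *
        Complex.exp (-2 * Real.pi * Complex.I * (r * c : ℝ) * x)) -
        2 * Real.pi * Complex.I * c * s * r * (v * conj (gaussianWindow (x - r * s)) *
        Complex.exp (-2 * Real.pi * Complex.I * (r * c : ℝ) * x))) r := by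
  have h1 : HasDerivAt (fun r : ℝ => -2 * Real.pi * Complex.I * (r * c : ℝ) * x)
      (-2 * Real.pi * Complex.I * c * x) r := by
    have := ((((hasDerivAt_id r).mul_const c).ofReal_comp).const_mul
      (-2 * Real.pi * Complex.I)).mul_const (x : ℂ)
    refine this.congr_deriv ?_
    simp
  have h2 := ((hasDerivAt_gaussianWindow_ray x s r).const_mul v).mul h1.cexp
  simp only [conj_gaussianWindow, mulGaussianWindow, map_mul, Complex.conj_ofReal]
  refine h2.congr_deriv ?_
  push_cast
  ring

theorem hasDerivAt_stft_ray (f : L2R) (c s r : ℝ) :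
    HasDerivAt (fun r : ℝ => stft gaussianWindow f (r * c, r * s))
      (2 * Real.pi * (s - Complex.I * c) * stft mulGaussianWindow f (r * c, r * s) -
        2 * Real.pi * Complex.I * c * s * r * stft gaussianWindow f (r * c, r * s)) r := by
  have hg := gaussianDominated_gaussianWindow
  have hm := gaussianDominated_mulGaussianWindow
  set C : ℝ := (2 : ℝ) ^ (1 / 4 : ℝ)
  set T : ℝ := (|r| + 1) * |s| with hT
  set E : ℝ := C * Real.exp (Real.pi / 2 * T ^ 2)
  set k₁ : ℂ := 2 * Real.pi * (s - Complex.I * c) with hk₁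
  set k₂ : ℂ := 2 * Real.pi * Complex.I * c * s with hk₂
  have hball : ∀ u ∈ Metric.ball r 1, |u| ≤ |r| + 1 := by
    intro u hu
    rw [Metric.mem_ball, Real.dist_eq] at hu
    have := abs_sub_abs_le_abs_sub u r
    linarith
  have key := hasDerivAt_integral_of_dominated_loc_of_deriv_le (μ := (volume : Measure ℝ))
    (F := fun (u : ℝ) (x : ℝ) => f x * conj (gaussianWindow (x - u * s)) *
        Complex.exp (-2 * Real.pi * Complex.I * (u * c : ℝ) * x))
    (F' := fun (u : ℝ) (x : ℝ) => k₁ * (f x * conj (mulGaussianWindow (x - u * s)) *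
        Complex.exp (-2 * Real.pi * Complex.I * (u * c : ℝ) * x)) -
        k₂ * u * (f x * conj (gaussianWindow (x - u * s)) *
        Complex.exp (-2 * Real.pi * Complex.I * (u * c : ℝ) * x)))
    (bound := fun x => ‖f x‖ * (((‖k₁‖ + ‖k₂‖ * (|r| + 1)) * E) *
      Real.exp (-(Real.pi / 4) * x ^ 2)))
    (x₀ := r) (Metric.ball_mem_nhds r one_pos) ?_ ?_ ?_ ?_ ?_ ?_
  · refine key.2.congr_deriv ?_
    rw [integral_sub, integral_const_mul, integral_const_mul]
    · rfl
    · exact (hm.integrable_integrand f _ _).const_mul _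
    · exact (hg.integrable_integrand f _ _).const_mul _
  · exact Filter.Eventually.of_forall fun u => hg.aestronglyMeasurable_integrand f _ _
  · exact hg.integrable_integrand f _ _
  · exact ((hm.aestronglyMeasurable_integrand f _ _).const_mul _).sub
      ((hg.aestronglyMeasurable_integrand f _ _).const_mul _)
  · refine Filter.Eventually.of_forall fun x u hu => ?_
    have hu' := hball u hu
    have ht : |u * s| ≤ T := by
      rw [abs_mul, hT]
      gcongr
    refine (norm_sub_le _ _).trans ?_
    rw [norm_mul, norm_mul (k₂ * u), norm_mul k₂, Complex.norm_real, Real.norm_eq_abs]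
    calc _ ≤ ‖k₁‖ * (‖f x‖ * (E * Real.exp (-(Real.pi / 4) * x ^ 2))) +
          ‖k₂‖ * (|r| + 1) * (‖f x‖ * (E * Real.exp (-(Real.pi / 4) * x ^ 2))) := by
          gcongr
          · exact hm.norm_integrand_le f ht _ _
          · exact hg.norm_integrand_le f ht _ _
      _ = _ := by ring
  · exact integrable_norm_mul_exp f _
  · refine Filter.Eventually.of_forall fun x u _ => ?_
    exact hasDerivAt_stft_integrand_ray (f x) x c s u

/-- Along a ray, the derivative of the spectrogram is controlled by two spectrograms. -/
theorem exists_hasDerivAt_spectrogram_ray (f : L2R) {c s : ℝ} (hcs : c ^ 2 + s ^ 2 = 1) (r : ℝ) :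
    ∃ d : ℝ, HasDerivAt (fun r : ℝ => ‖stft gaussianWindow f (r * c, r * s)‖ ^ 2) d r ∧
      |d| ≤ 2 * Real.pi * (‖stft gaussianWindow f (r * c, r * s)‖ ^ 2 +
        ‖stft mulGaussianWindow f (r * c, r * s)‖ ^ 2) := by
  have h := (hasDerivAt_stft_ray f c s r).norm_sq
  refine ⟨_, h, ?_⟩
  set V := stft gaussianWindow f (r * c, r * s)
  set W := stft mulGaussianWindow f (r * c, r * s)
  have hn : ‖(s - Complex.I * c : ℂ)‖ = 1 := by
    rw [← sq_eq_sq₀ (norm_nonneg _) zero_le_one, ← Complex.normSq_eq_norm_sq, Complex.normSq_apply]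
    simp
    linarith
  -- The second term of the derivative is a purely imaginary multiple of `V`: it turns the phase and
  -- leaves the modulus unchanged to first order. Thus no factor growing with `r` survives.
  have e : inner ℝ V (2 * Real.pi * (s - Complex.I * c) * W -
        2 * Real.pi * Complex.I * c * s * r * V) =
      inner ℝ V (2 * Real.pi * (s - Complex.I * c) * W) := by
    rw [inner_sub_right, sub_eq_self, Complex.inner]
    simp
    ring
  rw [e, abs_mul, abs_two]
  have h1 : |inner ℝ V (2 * Real.pi * (s - Complex.I * c) * W)| ≤ ‖V‖ * (2 * Real.pi * ‖W‖) := by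
    refine (abs_real_inner_le_norm _ _).trans_eq ?_
    rw [norm_mul, norm_mul, hn]
    simp [abs_of_pos Real.pi_pos]
  have := Real.pi_pos
  nlinarith [mul_nonneg this.le (sq_nonneg (‖V‖ - ‖W‖))]

/-- Integrating the derivative bound in either direction supplies the oscillation hypothesis of
`mul_lintegral_annuli_le`. -/
theorem spectrogram_ray_le (f : L2R) {c s : ℝ} (hcs : c ^ 2 + s ^ 2 = 1) {a b r u : ℝ}
    (hr : r ∈ Set.Icc a b) (hu : u ∈ Set.Icc a b) :
    ‖stft gaussianWindow f (r * c, r * s)‖ₑ ^ 2 ≤ ‖stft gaussianWindow f (u * c, u * s)‖ₑ ^ 2 +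
      ∫⁻ v in Set.Ioc a b, ENNReal.ofReal (2 * Real.pi) *
        (‖stft gaussianWindow f (v * c, v * s)‖ₑ ^ 2 +
          ‖stft mulGaussianWindow f (v * c, v * s)‖ₑ ^ 2) := by
  have hV : Continuous fun v : ℝ => stft gaussianWindow f (v * c, v * s) :=
    (gaussianDominated_gaussianWindow.continuous_stft f).comp (by fun_prop)
  have hW : Continuous fun v : ℝ => stft mulGaussianWindow f (v * c, v * s) :=
    (gaussianDominated_mulGaussianWindow.continuous_stft f).comp (by fun_prop)
  set D : ℝ → ℝ := fun v => 2 * Real.pi * (‖stft gaussianWindow f (v * c, v * s)‖ ^ 2 +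
        ‖stft mulGaussianWindow f (v * c, v * s)‖ ^ 2) with hD
  have hDc : Continuous D := by fun_prop
  have hD0 (v : ℝ) : 0 ≤ D v := by have := Real.pi_pos; positivity
  choose d hd hdD using exists_hasDerivAt_spectrogram_ray f hcs
  set G : ℝ → ℝ := fun v => ‖stft gaussianWindow f (v * c, v * s)‖ ^ 2 with hG
  have hGc : Continuous G := by fun_prop
  have hle : G r ≤ G u + ∫ v in Set.Ioc a b, D v := by
    have hsub {x y : ℝ} (hx : x ∈ Set.Icc a b) (hy : y ∈ Set.Icc a b) (hxy : x ≤ y) :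
        ∫ v in x..y, D v ≤ ∫ v in Set.Ioc a b, D v := by
      rw [intervalIntegral.integral_of_le hxy]
      exact setIntegral_mono_set (hDc.integrableOn_Icc.mono_set Set.Ioc_subset_Icc_self)
        (Filter.Eventually.of_forall hD0) (Set.Ioc_subset_Ioc hx.1 hy.2).eventuallyLE
    rcases le_total u r with h | h
    · have := intervalIntegral.sub_le_integral_of_hasDeriv_right_of_le h hGc.continuousOn
        (fun x _ => (hd x).hasDerivWithinAt) hDc.integrableOn_Icc
        (fun x _ => (le_abs_self _).trans (hdD x))
      linarith [hsub hu hr h]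
    · have := intervalIntegral.sub_le_integral_of_hasDeriv_right_of_le (g := fun v => -G v) h
        hGc.neg.continuousOn
        (fun x _ => (hd x).neg.hasDerivWithinAt) hDc.integrableOn_Icc
        (fun x _ => (neg_le_abs _).trans (hdD x))
      linarith [hsub hr hu h]
  have eG (v : ℝ) (ψ : ℝ → ℂ) : ‖stft ψ f (v * c, v * s)‖ₑ ^ 2 =
      ENNReal.ofReal (‖stft ψ f (v * c, v * s)‖ ^ 2) := by
    rw [ENNReal.ofReal_pow (norm_nonneg _), ofReal_norm]
  have eD (v : ℝ) : ENNReal.ofReal (2 * Real.pi) *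
        (‖stft gaussianWindow f (v * c, v * s)‖ₑ ^ 2 +
          ‖stft mulGaussianWindow f (v * c, v * s)‖ₑ ^ 2) = ENNReal.ofReal (D v) := by
    rw [eG, eG, ← ENNReal.ofReal_add (by positivity) (by positivity),
      ← ENNReal.ofReal_mul (by have := Real.pi_pos; positivity)]
  simp_rw [eD]
  rw [← ofReal_integral_eq_lintegral_ofReal
    (hDc.integrableOn_Icc.mono_set Set.Ioc_subset_Icc_self) (Filter.Eventually.of_forall hD0),
    eG, eG, ← ENNReal.ofReal_add (by positivity) (integral_nonneg hD0)]
  exact ENNReal.ofReal_le_ofReal hle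

/-! ### Polar integration and the energy on annuli -/

theorem lintegral_eq_polar {H : ℝ × ℝ → ℝ≥0∞} (hH : Measurable H) :
    ∫⁻ z, H z = ∫⁻ θ in Set.Ioo (-Real.pi) Real.pi, ∫⁻ r in Set.Ioi (0 : ℝ),
      ENNReal.ofReal r * H (r * Real.cos θ, r * Real.sin θ) := by
  rw [← lintegral_comp_polarCoord_symm, polarCoord_target, Measure.volume_eq_prod,
    ← Measure.prod_restrict, lintegral_prod_symm]
  · rfl
  · exact ((ENNReal.measurable_ofReal.comp measurable_fst).mul
      (hH.comp continuous_polarCoord_symm.measurable)).aemeasurable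

theorem enorm_stft_sq_le {ψ : ℝ → ℂ} (hψ : MemLp ψ 2 volume) (f : L2R) (z : ℝ × ℝ) :
    ‖stft ψ f z‖ₑ ^ 2 ≤ ‖f‖ₑ ^ 2 * ∫⁻ y, ‖ψ y‖ₑ ^ 2 := by
  have e : ∫⁻ y, ‖ψ y‖ₑ ^ 2 = ‖hψ.toLp‖ₑ ^ 2 := by
    rw [← lintegral_enorm_sq_eq]
    refine lintegral_congr_ae ?_
    filter_upwards [hψ.coeFn_toLp] with y hy
    rw [hy]
  rw [e, ← mul_pow]
  gcongr
  rw [← ofReal_norm, ← ofReal_norm, ← ofReal_norm, ← ENNReal.ofReal_mul (norm_nonneg _), mul_comm]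
  exact ENNReal.ofReal_le_ofReal (norm_stft_le hψ f z)

/-- The Jacobian `r` is missing on the left. For `r ≥ 1` inserting it only increases the integral,
which Moyal's formula bounds; for `r ≤ 1` the pointwise Cauchy–Schwarz bound suffices. -/
theorem GaussianDominated.lintegral_angular_le {ψ : ℝ → ℂ} {C : ℝ} (h : GaussianDominated ψ C)
    (f : L2R) :
    ∫⁻ θ in Set.Ioo (-Real.pi) Real.pi, ∫⁻ r in Set.Ioi (0 : ℝ),
      ‖stft ψ f (r * Real.cos θ, r * Real.sin θ)‖ₑ ^ 2 ≤
      (1 + ENNReal.ofReal (2 * Real.pi)) * (‖f‖ₑ ^ 2 * ∫⁻ y, ‖ψ y‖ₑ ^ 2) := by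
  have hm : Measurable fun z => ‖stft ψ f z‖ₑ ^ 2 :=
    (h.continuous_stft f).enorm.measurable.pow_const 2
  have hmr (θ : ℝ) : Measurable fun r : ℝ =>
      ENNReal.ofReal r * ‖stft ψ f (r * Real.cos θ, r * Real.sin θ)‖ₑ ^ 2 :=
    ENNReal.measurable_ofReal.mul
      (hm.comp (by fun_prop : Measurable fun r : ℝ => (r * Real.cos θ, r * Real.sin θ)))
  set Q : ℝ≥0∞ := ‖f‖ₑ ^ 2 * ∫⁻ y, ‖ψ y‖ₑ ^ 2 with hQ
  have hin (θ : ℝ) : ∫⁻ r in Set.Ioi (0 : ℝ),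
      ‖stft ψ f (r * Real.cos θ, r * Real.sin θ)‖ₑ ^ 2 ≤
      (∫⁻ r in Set.Ioi (0 : ℝ), ENNReal.ofReal r *
        ‖stft ψ f (r * Real.cos θ, r * Real.sin θ)‖ₑ ^ 2) + Q := by
    calc _ ≤ ∫⁻ r in Set.Ioi (0 : ℝ), (ENNReal.ofReal r *
        ‖stft ψ f (r * Real.cos θ, r * Real.sin θ)‖ₑ ^ 2 +
          (Set.Ioc (0 : ℝ) 1).indicator (fun _ => Q) r) := by
          refine setLIntegral_mono' measurableSet_Ioi fun r hr => ?_
          rcases le_total r 1 with h1 | h1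
          · rw [Set.indicator_of_mem (show r ∈ Set.Ioc (0 : ℝ) 1 from ⟨hr, h1⟩)]
            exact (enorm_stft_sq_le h.memLp f _).trans le_add_self
          · refine le_trans ?_ le_self_add
            exact le_mul_of_one_le_left zero_le (ENNReal.one_le_ofReal.2 h1)
      _ ≤ _ := by
          rw [lintegral_add_left (hmr θ)]
          gcongr
          refine (setLIntegral_le_lintegral _ _).trans ?_
          rw [lintegral_indicator_const measurableSet_Ioc]
          simp
  calc _ ≤ ∫⁻ θ in Set.Ioo (-Real.pi) Real.pi, ((∫⁻ r in Set.Ioi (0 : ℝ), ENNReal.ofReal r *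
        ‖stft ψ f (r * Real.cos θ, r * Real.sin θ)‖ₑ ^ 2) + Q) := lintegral_mono fun θ => hin θ
    _ = Q + Q * ENNReal.ofReal (2 * Real.pi) := by
        rw [lintegral_add_right _ measurable_const, ← lintegral_eq_polar hm,
          h.lintegral_enorm_stft_sq, setLIntegral_const, Real.volume_Ioo]
        congr 3
        ring
    _ = _ := by ring

/-- The spectrogram of a signal has little energy on a sparse union of thin annuli. -/
theorem exists_lintegral_annuli_spectrogram_le :
    ∃ C : NNReal, ∀ (f : L2R) (q : ℝ) (S : Finset ℕ) (N K : ℕ), 0 ≤ q → 0 < N →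
      1 ≤ Real.pi * q * N → (∀ p, (S.filter (fun m => m / N = p)).card ≤ K) →
      ∫⁻ z, {z : ℝ × ℝ | ∃ m ∈ S, z.1 ^ 2 + z.2 ^ 2 ∈ Set.Icc (q * m) (q * m + q)}.indicator
        (fun z => ‖stft gaussianWindow f z‖ₑ ^ 2) z ≤ ENNReal.ofReal (K * q * C) * ‖f‖ₑ ^ 2 := by
  have hg := gaussianDominated_gaussianWindow
  have hw := gaussianDominated_mulGaussianWindow
  set cg : ℝ≥0∞ := ∫⁻ y, ‖gaussianWindow y‖ₑ ^ 2 with hcg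
  set cw : ℝ≥0∞ := ∫⁻ y, ‖mulGaussianWindow y‖ₑ ^ 2 with hcw
  have hfin {ψ : ℝ → ℂ} (hψ : MemLp ψ 2 volume) : ∫⁻ y, ‖ψ y‖ₑ ^ 2 ≠ ⊤ := by
    have := (memLp_two_iff_integrable_sq_norm hψ.1).1 hψ
    have h2 := this.2
    rw [HasFiniteIntegral] at h2
    simpa using h2.ne
  set C₀ : ℝ≥0∞ := ENNReal.ofReal Real.pi *
    (cg + (1 + ENNReal.ofReal (2 * Real.pi)) * (cg + cw)) with hC₀
  have hC₀top : C₀ ≠ ⊤ := by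
    have h1 := hfin hg.memLp
    have h2 := hfin hw.memLp
    refine ENNReal.mul_ne_top ENNReal.ofReal_ne_top (ENNReal.add_ne_top.2 ⟨h1, ?_⟩)
    exact ENNReal.mul_ne_top (ENNReal.add_ne_top.2 ⟨ENNReal.one_ne_top, ENNReal.ofReal_ne_top⟩)
      (ENNReal.add_ne_top.2 ⟨h1, h2⟩)
  refine ⟨C₀.toNNReal, fun f q S N K hq hN hqN hK => ?_⟩
  set X : Set (ℝ × ℝ) := {z | ∃ m ∈ S, z.1 ^ 2 + z.2 ^ 2 ∈ Set.Icc (q * m) (q * m + q)} with hX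
  have hXm : MeasurableSet X := by
    have : X = ⋃ m ∈ S, (fun z : ℝ × ℝ => z.1 ^ 2 + z.2 ^ 2) ⁻¹' Set.Icc (q * m) (q * m + q) := by
      ext z
      simp only [hX, Set.mem_ofPred_eq, Set.mem_iUnion₂, Set.mem_preimage, exists_prop]
    rw [this]
    exact S.measurableSet_biUnion fun m _ =>
      (by fun_prop : Measurable fun z : ℝ × ℝ => z.1 ^ 2 + z.2 ^ 2) measurableSet_Icc
  have hVm : Measurable fun z => ‖stft gaussianWindow f z‖ₑ ^ 2 :=
    (hg.continuous_stft f).enorm.measurable.pow_const 2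
  have hWm : Measurable fun z => ‖stft mulGaussianWindow f z‖ₑ ^ 2 :=
    (hw.continuous_stft f).enorm.measurable.pow_const 2
  have hpolar (θ : ℝ) : Measurable fun r : ℝ => (r * Real.cos θ, r * Real.sin θ) := by fun_prop
  have hpolar2 : Measurable fun p : ℝ × ℝ => (p.2 * Real.cos p.1, p.2 * Real.sin p.1) := by fun_prop
  have hXpolar (θ r : ℝ) : X.indicator (fun z => ‖stft gaussianWindow f z‖ₑ ^ 2)
      (r * Real.cos θ, r * Real.sin θ) =
      {r : ℝ | ∃ m ∈ S, r ^ 2 ∈ Set.Icc (q * m) (q * m + q)}.indicator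
        (fun r => ‖stft gaussianWindow f (r * Real.cos θ, r * Real.sin θ)‖ₑ ^ 2) r := by
    have : (r * Real.cos θ) ^ 2 + (r * Real.sin θ) ^ 2 = r ^ 2 := by
      rw [mul_pow, mul_pow, ← mul_add, Real.cos_sq_add_sin_sq, mul_one]
    simp only [Set.indicator_apply, hX, Set.mem_ofPred_eq, this]
  set I : ℝ≥0∞ := ∫⁻ z, X.indicator (fun z => ‖stft gaussianWindow f z‖ₑ ^ 2) z with hI
  have hmain : (N : ℝ≥0∞) * I ≤ K * (‖f‖ₑ ^ 2 * cg + ENNReal.ofReal (q * N / 2) *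
      (ENNReal.ofReal (2 * Real.pi) * ((1 + ENNReal.ofReal (2 * Real.pi)) * (‖f‖ₑ ^ 2 * cg) +
        (1 + ENNReal.ofReal (2 * Real.pi)) * (‖f‖ₑ ^ 2 * cw)))) := by
    have hray (θ : ℝ) := mul_lintegral_annuli_le (hVm.comp (hpolar θ))
      (D := fun v => ENNReal.ofReal (2 * Real.pi) *
        (‖stft gaussianWindow f (v * Real.cos θ, v * Real.sin θ)‖ₑ ^ 2 +
          ‖stft mulGaussianWindow f (v * Real.cos θ, v * Real.sin θ)‖ₑ ^ 2))
      (fun a b r s _ hr hs => spectrogram_ray_le f (Real.cos_sq_add_sin_sq θ) hr hs) hq S hN hK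
    rw [hI, lintegral_eq_polar (hVm.indicator hXm), ← lintegral_const_mul' _ _ (by simp)]
    simp_rw [hXpolar]
    refine (lintegral_mono fun θ => hray θ).trans ?_
    have hD (θ : ℝ) : ∫⁻ r in Set.Ioi (0 : ℝ), ENNReal.ofReal (2 * Real.pi) *
        (‖stft gaussianWindow f (r * Real.cos θ, r * Real.sin θ)‖ₑ ^ 2 +
          ‖stft mulGaussianWindow f (r * Real.cos θ, r * Real.sin θ)‖ₑ ^ 2) =
        ENNReal.ofReal (2 * Real.pi) * ((∫⁻ r in Set.Ioi (0 : ℝ),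
          ‖stft gaussianWindow f (r * Real.cos θ, r * Real.sin θ)‖ₑ ^ 2) +
          ∫⁻ r in Set.Ioi (0 : ℝ),
            ‖stft mulGaussianWindow f (r * Real.cos θ, r * Real.sin θ)‖ₑ ^ 2) := by
      rw [lintegral_const_mul' _ _ ENNReal.ofReal_ne_top]
      congr 1
      exact lintegral_add_left (hVm.comp (hpolar θ)) _
    have hm1 : Measurable fun θ : ℝ => ∫⁻ r in Set.Ioi (0 : ℝ), ENNReal.ofReal r *
        ‖stft gaussianWindow f (r * Real.cos θ, r * Real.sin θ)‖ₑ ^ 2 :=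
      Measurable.lintegral_prod_right' (f := fun p : ℝ × ℝ => ENNReal.ofReal p.2 *
        ‖stft gaussianWindow f (p.2 * Real.cos p.1, p.2 * Real.sin p.1)‖ₑ ^ 2)
        ((ENNReal.measurable_ofReal.comp measurable_snd).mul (hVm.comp hpolar2))
    have hm2 : Measurable fun θ : ℝ => ∫⁻ r in Set.Ioi (0 : ℝ),
        ‖stft gaussianWindow f (r * Real.cos θ, r * Real.sin θ)‖ₑ ^ 2 :=
      Measurable.lintegral_prod_right' (hVm.comp hpolar2)
    simp only [Function.comp_apply, hD]
    rw [lintegral_const_mul' _ _ (by simp), lintegral_add_left hm1,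
      lintegral_const_mul' _ _ ENNReal.ofReal_ne_top,
      lintegral_const_mul' _ _ ENNReal.ofReal_ne_top, lintegral_add_left hm2,
      ← lintegral_eq_polar hVm, hg.lintegral_enorm_stft_sq]
    gcongr
    · exact hg.lintegral_angular_le f
    · exact hw.lintegral_angular_le f
  have hN0 : (N : ℝ≥0∞) ≠ 0 := by exact_mod_cast hN.ne'
  have hNt : (N : ℝ≥0∞) ≠ ⊤ := ENNReal.natCast_ne_top N
  refine (ENNReal.mul_le_mul_iff_right hN0 hNt).1 (hmain.trans ?_)
  -- Since `πqN ≥ 1`, the mean-value term is absorbed into a term proportional to `qN`; `N` then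
  -- cancels.
  have h1 : (1 : ℝ≥0∞) ≤ ENNReal.ofReal Real.pi * ENNReal.ofReal q * N := by
    rw [← ENNReal.ofReal_natCast, ← ENNReal.ofReal_mul Real.pi_pos.le,
      ← ENNReal.ofReal_mul (mul_nonneg Real.pi_pos.le hq)]
    exact ENNReal.one_le_ofReal.2 hqN
  have h2 : ENNReal.ofReal (q * N / 2) * ENNReal.ofReal (2 * Real.pi) =
      ENNReal.ofReal Real.pi * ENNReal.ofReal q * N := by
    rw [← ENNReal.ofReal_natCast, ← ENNReal.ofReal_mul Real.pi_pos.le,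
      ← ENNReal.ofReal_mul (mul_nonneg Real.pi_pos.le hq), ← ENNReal.ofReal_mul (by positivity)]
    congr 1
    ring
  have h3 : ENNReal.ofReal (K * q * C₀.toNNReal) = K * ENNReal.ofReal q * C₀ := by
    rw [ENNReal.ofReal_mul (by positivity), ENNReal.ofReal_mul (by positivity),
      ENNReal.ofReal_natCast, ENNReal.ofReal_coe_nnreal, ENNReal.coe_toNNReal hC₀top]
  rw [h3, ← mul_assoc (ENNReal.ofReal (q * N / 2)), h2]
  calc _ ≤ (K : ℝ≥0∞) * ((ENNReal.ofReal Real.pi * ENNReal.ofReal q * N) * (‖f‖ₑ ^ 2 * cg) +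
      (ENNReal.ofReal Real.pi * ENNReal.ofReal q * N) *
        ((1 + ENNReal.ofReal (2 * Real.pi)) * (‖f‖ₑ ^ 2 * cg) +
        (1 + ENNReal.ofReal (2 * Real.pi)) * (‖f‖ₑ ^ 2 * cw))) := by
        refine mul_le_mul' le_rfl (add_le_add (le_mul_of_one_le_left zero_le h1) le_rfl)
    _ = _ := by rw [hC₀]; ring

/-! ### Counting Cantor points in blocks, and the choice of scale -/

theorem ncard_discreteCantorSet_le (M : ℕ) (A : Finset ℕ) (n : ℕ) :
    (discreteCantorSet M A n).ncard ≤ A.card ^ n := by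
  have h : discreteCantorSet M A n ⊆ ↑((Fintype.piFinset fun _ : Fin n => A).image
      fun a : Fin n → ℕ => ∑ j, a j * M ^ (j : ℕ)) := by
    rintro m ⟨a, ha, rfl⟩
    exact Finset.mem_coe.2 (Finset.mem_image.2 ⟨a, Fintype.mem_piFinset.2 ha, rfl⟩)
  refine (Set.ncard_le_ncard h (Finset.finite_toSet _)).trans ?_
  rw [Set.ncard_coe_finset]
  refine Finset.card_image_le.trans ?_
  simp

/-- Modulo `M^l` only the `l` lowest digits matter. Residues are taken on both sides because the
digits in `A` are not assumed to be below `M` here. -/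
theorem mod_mem_of_mem_discreteCantorSet {M : ℕ} {A : Finset ℕ} {l j m : ℕ}
    (hm : m ∈ discreteCantorSet M A (l + j)) :
    m % M ^ l ∈ (· % M ^ l) '' discreteCantorSet M A l := by
  obtain ⟨a, ha, rfl⟩ := hm
  refine ⟨∑ i : Fin l, a (Fin.castAdd j i) * M ^ (i : ℕ), ⟨_, fun i => ha _, rfl⟩, ?_⟩
  have : ∑ i : Fin j, a (Fin.natAdd l i) * M ^ (l + (i : ℕ)) =
      M ^ l * ∑ i : Fin j, a (Fin.natAdd l i) * M ^ (i : ℕ) := by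
    rw [Finset.mul_sum]
    exact Finset.sum_congr rfl fun i _ => by ring
  simp only [Fin.sum_univ_add, Fin.val_castAdd, Fin.val_natAdd, this, Nat.add_mul_mod_self_left]

/-- A block of `M ^ l` consecutive integers contains at most `|A| ^ l` points of a discrete
Cantor set. -/
theorem card_filter_div_discreteCantorSet_le (M : ℕ) (A : Finset ℕ) (l j p : ℕ) :
    ((finite_discreteCantorSet M A (l + j)).toFinset.filter (fun m => m / M ^ l = p)).card ≤
      A.card ^ l := by
  refine le_trans ?_ (ncard_discreteCantorSet_le M A l)
  refine le_trans ?_ (Set.ncard_image_le (f := (· % M ^ l)) (finite_discreteCantorSet M A l))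
  rw [← Set.ncard_coe_finset]
  refine Set.ncard_le_ncard_of_injOn (· % M ^ l) ?_ ?_
    ((finite_discreteCantorSet M A l).image _)
  · intro m hm
    simp only [Finset.coe_filter, Set.Finite.mem_toFinset, Set.mem_ofPred_eq] at hm
    exact mod_mem_of_mem_discreteCantorSet hm.1
  · intro m hm m' hm' h
    simp only [Finset.coe_filter, Set.Finite.mem_toFinset, Set.mem_ofPred_eq] at hm hm' h
    rw [← Nat.div_add_mod m (M ^ l), ← Nat.div_add_mod m' (M ^ l), hm.2, hm'.2, h]

theorem sphericalCantorSet_eq (R : ℝ) (M : ℕ) (A : Finset ℕ) (n : ℕ) :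
    sphericalCantorSet R M A n = {z | ∃ m ∈ (finite_discreteCantorSet M A n).toFinset,
      z.1 ^ 2 + z.2 ^ 2 ∈ Set.Icc (R ^ 2 / (M : ℝ) ^ n * m)
        (R ^ 2 / (M : ℝ) ^ n * m + R ^ 2 / (M : ℝ) ^ n)} := by
  ext z
  simp only [sphericalCantorSet, cantorSet, Set.mem_ofPred_eq, Set.mem_iUnion₂,
    Set.Finite.mem_toFinset, exists_prop]

/-- A scale at which the blocks of the Cantor set have area at least one, but comparable to one
when the whole disk is large. -/
theorem exists_scale {M : ℕ} (hM : 2 ≤ M) {A : Finset ℕ} (n : ℕ) {R : ℝ} (hR : 0 < R)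
    (hRn : Real.pi * R ^ 2 ≤ (M : ℝ) ^ n) :
    ∃ j N : ℕ, j ≤ n ∧ 0 < N ∧ Real.pi * R ^ 2 < (M : ℝ) ^ (j + 1) ∧
      1 ≤ Real.pi * (R ^ 2 / (M : ℝ) ^ n) * N ∧
      ∀ p, ((finite_discreteCantorSet M A n).toFinset.filter (fun m => m / N = p)).card ≤
        A.card ^ (n - j) := by
  have hM1 : (1 : ℝ) < M := by exact_mod_cast hM
  have hL : 0 < Real.pi * R ^ 2 := by have := Real.pi_pos; positivity
  rcases le_or_gt 1 (Real.pi * R ^ 2) with h | h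
  · obtain ⟨j, hj1, hj2⟩ := exists_nat_pow_near h hM1
    have hjn : j ≤ n := (pow_le_pow_iff_right₀ hM1).1 (hj1.trans hRn)
    refine ⟨j, M ^ (n - j), hjn, by positivity, hj2, ?_, fun p => ?_⟩
    · push_cast
      have hp : (M : ℝ) ^ n = (M : ℝ) ^ (n - j) * (M : ℝ) ^ j := by
        rw [← pow_add, Nat.sub_add_cancel hjn]
      have e : Real.pi * (R ^ 2 / (M : ℝ) ^ n) * (M : ℝ) ^ (n - j) =
          Real.pi * R ^ 2 / (M : ℝ) ^ j := by
        rw [hp]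
        field_simp
      rw [e]
      exact (one_le_div (by positivity)).2 hj1
    · have := card_filter_div_discreteCantorSet_le M A (n - j) j p
      rwa [Nat.sub_add_cancel hjn] at this
  -- For a disk of area below one, a single block of area at least one contains everything, and the
  -- trivial count `|A|^n` corresponds to `j = 0`.
  · have hδ : 0 < Real.pi * (R ^ 2 / (M : ℝ) ^ n) := by have := Real.pi_pos; positivity
    obtain ⟨N, hN⟩ := exists_nat_ge (1 / (Real.pi * (R ^ 2 / (M : ℝ) ^ n)))
    refine ⟨0, N, n.zero_le, ?_, ?_, ?_, fun p => ?_⟩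
    · have : (0 : ℝ) < N := lt_of_lt_of_le (by positivity) hN
      exact_mod_cast this
    · simpa using h.trans hM1
    · rwa [div_le_iff₀' hδ] at hN
    · refine (Finset.card_filter_le _ _).trans ?_
      rw [← Set.ncard_eq_toFinset_card _ (finite_discreteCantorSet M A n)]
      exact ncard_discreteCantorSet_le M A n

/-! ### Numerical bounds, the operator norm, and the conclusion -/

theorem rpow_log_div_log_le {M k : ℕ} (hM : 2 ≤ M) (hk : 1 ≤ k) {x : ℝ} (hx : 0 ≤ x) {i : ℕ}
    (h : x ≤ (M : ℝ) ^ i) : x ^ (Real.log k / Real.log M) ≤ (k : ℝ) ^ i := by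
  have hM1 : (1 : ℝ) < M := by exact_mod_cast hM
  have hk1 : (1 : ℝ) ≤ k := by exact_mod_cast hk
  have hs : 0 ≤ Real.log k / Real.log M :=
    div_nonneg (Real.log_nonneg hk1) (Real.log_nonneg hM1.le)
  refine (Real.rpow_le_rpow hx h hs).trans_eq ?_
  rw [← Real.rpow_natCast, ← Real.rpow_mul (by positivity), mul_comm, Real.rpow_mul (by positivity),
    Real.log_div_log, Real.rpow_logb (by positivity) hM1.ne' (by positivity), Real.rpow_natCast]

/-- From `e^(-δ) ≤ 1/(1+δ)` one gets `1 - e^(-δ) ≥ δ/(1+δ)`, and `1 + δ ≤ 2`. -/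
theorem half_le_one_sub_exp_neg {δ : ℝ} (h0 : 0 ≤ δ) (h1 : δ ≤ 1) :
    δ / 2 ≤ 1 - Real.exp (-δ) := by
  have h2 : Real.exp (-δ) * (1 + δ) ≤ 1 := by
    have := Real.add_one_le_exp δ
    calc Real.exp (-δ) * (1 + δ) ≤ Real.exp (-δ) * Real.exp δ := by
          gcongr; linarith
      _ = 1 := by rw [← Real.exp_add]; simp
  nlinarith [Real.exp_pos (-δ), mul_nonneg h0 (sub_nonneg.2 h1)]

/-- An energy bound for the short-time Fourier transform on a set bounds the corresponding
localization operator. -/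
theorem norm_localizationOperator_indicator_le {φ : ℝ → ℂ} (hφ : MemLp φ 2 volume)
    {X : Set (ℝ × ℝ)} (hX : MeasurableSet X)
    (hF : Integrable (X.indicator (1 : ℝ × ℝ → ℝ)) volume) {κ : ℝ} (hκ : 0 ≤ κ)
    (h : ∀ f : L2R, ∫⁻ z, X.indicator (fun z => ‖stft φ f z‖ₑ ^ 2) z ≤
      ENNReal.ofReal κ * ‖f‖ₑ ^ 2) :
    ‖localizationOperator φ (X.indicator 1) hφ hF‖ ≤ κ := by
  have hsq (f : L2R) : (∫⁻ z in X, ‖stft φ f z‖ₑ ^ (2 : ℝ)) ^ (1 / (2 : ℝ)) ≤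
      ENNReal.ofReal (√κ * ‖f‖) := by
    have e : ENNReal.ofReal κ * ‖f‖ₑ ^ 2 = ENNReal.ofReal (√κ * ‖f‖) ^ (2 : ℝ) := by
      rw [ENNReal.rpow_two, ← ENNReal.ofReal_pow (by positivity), mul_pow, Real.sq_sqrt hκ,
        ENNReal.ofReal_mul hκ, ENNReal.ofReal_pow (norm_nonneg _), ofReal_norm]
    have h1 := h f
    rw [lintegral_indicator hX, e] at h1
    simp_rw [ENNReal.rpow_two] at h1 ⊢
    refine (ENNReal.rpow_le_rpow h1 (by norm_num)).trans_eq ?_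
    rw [← ENNReal.rpow_two, ← ENNReal.rpow_mul]
    norm_num
  have hform (f g : L2R) : ‖inner ℂ g (localizationOperator φ (X.indicator 1) hφ hF f)‖ ≤
      κ * ‖f‖ * ‖g‖ := by
    rw [inner_localizationOperator]
    have e : ENNReal.ofReal ‖∫ z, ((X.indicator (1 : ℝ × ℝ → ℝ) z : ℝ) : ℂ) * stft φ f z *
        conj (stft φ g z)‖ ≤ ENNReal.ofReal (κ * ‖f‖ * ‖g‖) := by
      rw [ofReal_norm]
      calc _ ≤ ∫⁻ z, ‖((X.indicator (1 : ℝ × ℝ → ℝ) z : ℝ) : ℂ) * stft φ f z *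
            conj (stft φ g z)‖ₑ := enorm_integral_le_lintegral_enorm _
        _ = ∫⁻ z in X, ((fun z => ‖stft φ f z‖ₑ) * fun z => ‖stft φ g z‖ₑ) z := by
            rw [← lintegral_indicator hX]
            refine lintegral_congr fun z => ?_
            by_cases hz : z ∈ X <;> simp [hz]
        _ ≤ (∫⁻ z in X, ‖stft φ f z‖ₑ ^ (2 : ℝ)) ^ (1 / (2 : ℝ)) *
            (∫⁻ z in X, ‖stft φ g z‖ₑ ^ (2 : ℝ)) ^ (1 / (2 : ℝ)) :=
            ENNReal.lintegral_mul_le_Lp_mul_Lq _ Real.HolderConjugate.two_two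
              (aestronglyMeasurable_stft hφ f).enorm.restrict
              (aestronglyMeasurable_stft hφ g).enorm.restrict
        _ ≤ ENNReal.ofReal (√κ * ‖f‖) * ENNReal.ofReal (√κ * ‖g‖) :=
            mul_le_mul' (hsq f) (hsq g)
        _ = _ := by
            rw [← ENNReal.ofReal_mul (by positivity)]
            congr 1
            rw [mul_mul_mul_comm, Real.mul_self_sqrt hκ, mul_assoc]
    exact (ENNReal.ofReal_le_ofReal_iff (by positivity)).1 e
  refine ContinuousLinearMap.opNorm_le_bound _ hκ fun f => ?_
  -- Testing the form bound with `g = P f` gives `‖P f‖² ≤ κ ‖f‖ ‖P f‖`.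
  have h1 := hform f (localizationOperator φ (X.indicator 1) hφ hF f)
  rw [inner_self_eq_norm_sq_to_K, norm_pow, RCLike.norm_ofReal, abs_norm, sq] at h1
  rcases (norm_nonneg (localizationOperator φ (X.indicator 1) hφ hF f)).eq_or_lt with h0 | h0
  · rw [← h0]; positivity
  · exact le_of_mul_le_mul_right h1 h0

end Daubechies

theorem mainTheorem2 :
    ∀ M k : ℕ, ∃ B : ℝ, 0 < B ∧
      ∀ A : Finset ℕ, A.Nonempty → A ⊂ Finset.range M → A.card = k →
      ∀ n : ℕ, ∀ R : ℝ, 0 ≤ R → Real.pi * R ^ 2 ∈ Set.Icc (0 : ℝ) ((M : ℝ) ^ n) →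
        (Real.pi * R ^ 2 + 1) ^ (Real.log (A.card : ℝ) / Real.log (M : ℝ)) /
            ((A.card : ℝ) ^ n * (1 - Real.exp (-(Real.pi * R ^ 2 / (M : ℝ) ^ n)))) *
          ‖Daubechies.cantorLocalizationOperator R M A n‖ ≤ B := by
  intro M k
  obtain ⟨C, hC⟩ := Daubechies.exists_lintegral_annuli_spectrogram_le
  have hπ := Real.pi_pos
  -- The factor `k²` comes from `|A|^(j+2)` against `|A|^j`, the factor `2/π` from `1 - e^(-πq) ≥
  -- πq/2`; the `+ 1` ensures positivity.
  refine ⟨k ^ 2 * C * 2 / Real.pi + 1, by positivity, ?_⟩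
  rintro A hA hAM rfl n R hR ⟨-, hRn⟩
  have hk : 1 ≤ A.card := hA.card_pos
  have hM : 2 ≤ M := by
    have := Finset.card_lt_card hAM
    rw [Finset.card_range] at this
    omega
  have hk0 : (0 : ℝ) < A.card := by exact_mod_cast hk
  have hM0 : (0 : ℝ) < M := by positivity
  -- At `R = 0` the denominator vanishes, and division by zero makes the left side `0`.
  rcases hR.eq_or_lt with rfl | hR
  · simp
    positivity
  obtain ⟨j, N, hjn, hN, hLj, hqN, hcard⟩ := Daubechies.exists_scale (A := A) hM n hR hRn
  set q : ℝ := R ^ 2 / (M : ℝ) ^ n with hq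
  have hq0 : 0 < q := by positivity
  have hδ : Real.pi * R ^ 2 / (M : ℝ) ^ n = Real.pi * q := by rw [hq]; ring
  have hδ1 : Real.pi * q ≤ 1 := by
    rw [← hδ]
    exact div_le_one_of_le₀ hRn (by positivity)
  have hnorm : ‖Daubechies.cantorLocalizationOperator R M A n‖ ≤
      (A.card : ℝ) ^ (n - j) * q * C := by
    refine Daubechies.norm_localizationOperator_indicator_le _
      (Daubechies.isCompact_sphericalCantorSet R M A n).measurableSet _ (by positivity) fun f => ?_
    rw [Daubechies.sphericalCantorSet_eq]
    have := hC f q _ N (A.card ^ (n - j)) hq0.le hN hqN hcard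
    push_cast at this
    exact this
  -- The exponent is `j + 2` because `πR² + 1 ≤ 2 M^(j+1) ≤ M^(j+2)`.
  have hpow : (Real.pi * R ^ 2 + 1) ^ (Real.log (A.card : ℝ) / Real.log (M : ℝ)) ≤
      (A.card : ℝ) ^ (j + 2) := by
    refine Daubechies.rpow_log_div_log_le hM hk (by positivity) ?_
    have h1 : (1 : ℝ) ≤ (M : ℝ) ^ (j + 1) := one_le_pow₀ (by exact_mod_cast hM.trans' one_le_two)
    have h2 : (2 : ℝ) ≤ M := by exact_mod_cast hM
    calc Real.pi * R ^ 2 + 1 ≤ (M : ℝ) ^ (j + 1) * 2 := by linarith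
      _ ≤ (M : ℝ) ^ (j + 1) * M := by gcongr
      _ = _ := by ring
  have hexp := Daubechies.half_le_one_sub_exp_neg (by positivity : 0 ≤ Real.pi * q) hδ1
  rw [hδ]
  calc _ ≤ (A.card : ℝ) ^ (j + 2) / ((A.card : ℝ) ^ n * (Real.pi * q / 2)) *
        ((A.card : ℝ) ^ (n - j) * q * C) := by gcongr
    _ = (A.card : ℝ) ^ 2 * C * 2 / Real.pi := by
        have e : (A.card : ℝ) ^ n = (A.card : ℝ) ^ (n - j) * (A.card : ℝ) ^ j := by
          rw [← pow_add, Nat.sub_add_cancel hjn]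
        rw [e]
        field_simp
        ring
    _ ≤ _ := by linarith
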